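/- Let $M$ be a metric space with distance $d$ and a fixed base point $0\in M$. Let $\mathrm{Lip}_0(M)$ be the real Banach space of all Lipschitz functions $f\colon M\to\mathbb{R}$ with $f(0)=0$, with the norm $\|f\|=\sup\{|f(x)-f(y)|/d(x,y)\colon x\neq y\}$. Put $\widetilde M=\{(x,y)\in M\times M\colon x\neq y\}$, and let $ba(\widetilde M)$ be the space of bounded finitely additive signed measures on the power set of $\widetilde M$ with the total variation norm $\|\mu\|=|\mu|(\widetilde M)$. For $\mu\in ba(\widetilde M)$ let $\Phi^*\mu\in \mathrm{Lip}_0(M)^*$ be the functional $$(\Phi^*\mu)(f)=\int_{\widetilde M}\frac{f(x)-f(y)}{d(x,y)}\,d\mu(x,y).$$ Call $\mu\in ba(\widetilde M)$ *optimal* if it is positive and $\|\Phi^*\mu\|=\|\mu\|$. For $\gamma\in(0,1]$, call a set $A\subseteq\widetilde M$ *$\gamma$-cyclically monotonic* if for every finite sequence $(x_1,y_1),\dots,(x_k,y_k)\in A$, $$\sum_{i=1}^k\min\{d(x_i,y_{i+1})-\gamma d(x_i,y_i),\ d(y_i,y_{i+1})\}\ge 0,\qquad\text{where } y_{k+1}=y_1.$$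 A slice of the closed unit ball $B_X$ of a real Banach space $X$ is a set $\{x\in B_X\colon x^*(x)>1-\alpha\}$ with $x^*\in X^*$, $\|x^*\|=1$ and $\alpha>0$. The space $X$ has the *strong diameter 2 property* if $\sum_{i=1}^n\lambda_iS_i$ has diameter $2$ whenever $n\ge1$, $\lambda_1,\dots,\lambda_n\ge0$, $\sum_{i=1}^n\lambda_i=1$, and $S_1,\dots,S_n$ are slices of $B_X$. **Proposition.** The space $\mathrm{Lip}_0(M)$ has the strong diameter 2 property if and only if for every $n\ge1$, all optimal $\mu_1,\dots,\mu_n\in ba(\widetilde M)$ with $\|\mu_i\|=1$, and every $\gamma\in(0,1)$, there exist subsets $A_1,\dots,A_n$ of $\widetilde M$ and $u,v\in M$ with $u\neq v$ such that for all $i\in\{1,\dots,n\}$, $\mu_i(A_i)\ge\gamma$ and the sets $A_i\cup\{(u,v)\}$ and $A_i\cup\{(v,u)\}$ are both $\gamma$-cyclically monotonic. -/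

import Mathlib

noncomputable section

/-! ### Slices and the strong diameter two property -/

/-- A slice of the closed unit ball of a real normed space `X`: a set of the form
`{x ∈ B_X | F x > 1 - α}` with `F` of norm one in the dual of `X` and `α > 0`. -/
def IsSlice {X : Type*} [NormedAddCommGroup X] [NormedSpace ℝ X] (S : Set X) : Prop :=
  ∃ (F : StrongDual ℝ X) (α : ℝ), ‖F‖ = 1 ∧ 0 < α ∧ S = {x : X | ‖x‖ ≤ 1 ∧ 1 - α < F x}

/-- The strong diameter two property: every convex combination of slices of the unit ball
has diameter `2`. (The condition `∑ i, lam i = 1` forces `n ≥ 1`.) -/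
def HasSD2P (X : Type*) [NormedAddCommGroup X] [NormedSpace ℝ X] : Prop :=
  ∀ (n : ℕ) (lam : Fin n → ℝ) (S : Fin n → Set X),
    (∀ i, 0 ≤ lam i) → ∑ i, lam i = 1 → (∀ i, IsSlice (S i)) →
      Metric.diam {x : X | ∃ s : Fin n → X, (∀ i, s i ∈ S i) ∧ x = ∑ i, lam i • s i} = 2

/-! ### Bounded finitely additive signed measures on the power set of a set -/

/-- `BA S` is the set of bounded finitely additive signed measures on the power set of `S`. -/
structure BA (S : Type*) extends MeasureTheory.AddContent ℝ (Set.univ : Set (Set S)) where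
  bounded' : ∃ C : ℝ, ∀ A : Set S, |toFun A| ≤ C

namespace BA

variable {S : Type*}

instance : CoeFun (BA S) (fun _ => Set S → ℝ) := ⟨fun μ => μ.toFun⟩

/-- The total variation `|μ|(E)`: the supremum of `∑ |μ B|` over all finite families of
pairwise disjoint subsets `B` of `E`. -/
def variation (μ : BA S) (E : Set S) : ℝ :=
  sSup {r : ℝ | ∃ P : Finset (Set S), (P : Set (Set S)).PairwiseDisjoint id ∧
    (∀ B ∈ P, B ⊆ E) ∧ r = ∑ B ∈ P, |μ B|}

/-- The norm `‖μ‖ = |μ|(S)`. -/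
instance : Norm (BA S) := ⟨fun μ => μ.variation Set.univ⟩

/-- `μ` is positive if it takes nonnegative values only. -/
def IsPositive (μ : BA S) : Prop := ∀ A : Set S, 0 ≤ μ A

/-- The integral `∑ c, c * μ {s = c}` of a function `s` that takes only finitely many values. -/
def simpleIntegral (μ : BA S) (s : S → ℝ) : ℝ := ∑ᶠ c : ℝ, c * μ (s ⁻¹' {c})

/-- The rounding of `f` down to a multiple of `1 / (n + 1)`; if `f` is bounded, it takes only
finitely many values, and it converges to `f` uniformly as `n → ∞`. -/
def approx (n : ℕ) (f : S → ℝ) : S → ℝ := fun x => (⌊((n : ℝ) + 1) * f x⌋ : ℝ) / ((n : ℝ) + 1)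

/-- The integral of a bounded function `f : S → ℝ` with respect to a bounded finitely additive
signed measure, as the limit of the integrals of functions with finitely many values that converge
to `f` uniformly. (Its independence of the approximation is `abs_integral_sub_simpleIntegral_le`
below.) -/
def integral (μ : BA S) (f : S → ℝ) : ℝ :=
  Filter.limUnder Filter.atTop (fun n : ℕ => μ.simpleIntegral (approx n f))

theorem variation_bddAbove (μ : BA S) (E : Set S) :
    BddAbove {r : ℝ | ∃ P : Finset (Set S), (P : Set (Set S)).PairwiseDisjoint id ∧
      (∀ B ∈ P, B ⊆ E) ∧ r = ∑ B ∈ P, |μ B|} := by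
  classical
  obtain ⟨C, hC⟩ := μ.bounded'
  refine ⟨2 * C, ?_⟩
  rintro r ⟨P, hP, -, rfl⟩
  have key : ∀ Q : Finset (Set S), Q ⊆ P → |∑ B ∈ Q, μ B| ≤ C := by
    intro Q hQ
    rw [← μ.sUnion' Q (Set.subset_univ _)
      (hP.subset (by exact_mod_cast hQ)) (Set.mem_univ _)]
    exact hC _
  rw [← Finset.sum_filter_add_sum_filter_not P (fun B => 0 ≤ μ B)]
  have h1 : ∑ B ∈ P.filter (fun B => 0 ≤ μ B), |μ B|
      = ∑ B ∈ P.filter (fun B => 0 ≤ μ B), μ B :=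
    Finset.sum_congr rfl fun B hB => abs_of_nonneg (Finset.mem_filter.1 hB).2
  have h2 : ∑ B ∈ P.filter (fun B => ¬ 0 ≤ μ B), |μ B|
      = - ∑ B ∈ P.filter (fun B => ¬ 0 ≤ μ B), μ B := by
    rw [← Finset.sum_neg_distrib]
    exact Finset.sum_congr rfl fun B hB =>
      abs_of_neg (not_le.1 (Finset.mem_filter.1 hB).2)
  rw [h1, h2]
  have h3 := abs_le.1 (key _ (Finset.filter_subset (fun B => 0 ≤ μ B) P))
  have h4 := abs_le.1 (key _ (Finset.filter_subset (fun B => ¬ 0 ≤ μ B) P))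
  linarith [h3.2, h4.1]

theorem sum_abs_le_norm (μ : BA S) {ι : Type*} (T : Finset ι) (f : ι → Set S)
    (hf : (T : Set ι).PairwiseDisjoint f) : ∑ i ∈ T, |μ (f i)| ≤ ‖μ‖ := by
  classical
  have h0 : μ ∅ = 0 := μ.empty'
  have h : ∑ B ∈ T.image f, |μ B| = ∑ i ∈ T, |μ (f i)| := by
    apply Finset.sum_image_of_pairwise_eq_zero
    intro i hi j hj hij hEq
    have hd := hf hi hj hij
    simp only [Function.onFun, ← hEq, disjoint_self, Set.bot_eq_empty] at hd
    rw [hd, h0, abs_zero]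
  rw [← h]
  refine le_csSup (μ.variation_bddAbove Set.univ)
    ⟨T.image f, ?_, fun B _ => Set.subset_univ B, rfl⟩
  rw [Finset.coe_image]
  exact hf.image

theorem norm_nonneg' (μ : BA S) : 0 ≤ ‖μ‖ := by
  simpa using μ.sum_abs_le_norm (∅ : Finset ℕ) (fun _ => ∅) (by simp)

theorem simpleIntegral_comp (μ : BA S) {ι : Type*} (T : Finset ι) (g : S → ι)
    (hg : ∀ x, g x ∈ T) (φ : ι → ℝ) :
    μ.simpleIntegral (fun x => φ (g x)) = ∑ i ∈ T, φ i * μ (g ⁻¹' {i}) := by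
  classical
  have h0 : μ ∅ = 0 := μ.empty'
  have hsupp : (Function.support fun c : ℝ => c * μ ((fun x => φ (g x)) ⁻¹' {c}))
      ⊆ (T.image φ : Finset ℝ) := by
    intro c hc
    by_contra hcT
    apply hc
    have : (fun x => φ (g x)) ⁻¹' {c} = ∅ := by
      ext x
      simp only [Set.mem_preimage, Set.mem_singleton_iff, Set.mem_empty_iff_false, iff_false]
      intro hx
      exact hcT (by simpa using ⟨g x, hg x, hx⟩)
    simp [this, h0]
  rw [simpleIntegral, finsum_eq_sum_of_support_subset _ hsupp,
    ← Finset.sum_fiberwise_of_maps_to (fun i hi => Finset.mem_image_of_mem φ hi)]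
  refine Finset.sum_congr rfl fun c _ => ?_
  have hU : (fun x => φ (g x)) ⁻¹' {c} = ⋃ i ∈ T.filter (fun i => φ i = c), g ⁻¹' {i} := by
    ext x
    simp only [Set.mem_preimage, Set.mem_singleton_iff, Finset.mem_filter, Set.mem_iUnion,
      exists_prop]
    exact ⟨fun hx => ⟨g x, ⟨hg x, hx⟩, rfl⟩, fun ⟨i, ⟨_, hi⟩, hx⟩ => hx ▸ hi⟩
  have hadd : μ (⋃ i ∈ T.filter (fun i => φ i = c), g ⁻¹' {i})
      = ∑ i ∈ T.filter (fun i => φ i = c), μ (g ⁻¹' {i}) := by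
    refine MeasureTheory.addContent_biUnion (m := μ.toAddContent) (fun _ _ => Set.mem_univ _) ?_
      (Set.mem_univ _)
    intro i _ j _ hij
    rw [Function.onFun, Set.disjoint_left]
    rintro x hx hx'
    exact hij (hx.symm.trans hx')
  rw [hU, hadd, Finset.mul_sum]
  refine Finset.sum_congr rfl fun i hi => ?_
  rw [(Finset.mem_filter.1 hi).2]

theorem simpleIntegral_add (μ : BA S) (s t : S → ℝ) (hs : (Set.range s).Finite)
    (ht : (Set.range t).Finite) :
    μ.simpleIntegral (fun x => s x + t x) = μ.simpleIntegral s + μ.simpleIntegral t := by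
  classical
  have hg : ∀ x, (s x, t x) ∈ hs.toFinset ×ˢ ht.toFinset := fun x => by simp
  have h1 := μ.simpleIntegral_comp _ (fun x => (s x, t x)) hg (fun p => p.1 + p.2)
  have h2 := μ.simpleIntegral_comp _ (fun x => (s x, t x)) hg (fun p => p.1)
  have h3 := μ.simpleIntegral_comp _ (fun x => (s x, t x)) hg (fun p => p.2)
  change μ.simpleIntegral s = _ at h2
  change μ.simpleIntegral t = _ at h3
  rw [h1, h2, h3, ← Finset.sum_add_distrib]
  exact Finset.sum_congr rfl fun p _ => add_mul _ _ _

theorem simpleIntegral_smul (μ : BA S) (c : ℝ) (s : S → ℝ) (hs : (Set.range s).Finite) :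
    μ.simpleIntegral (fun x => c * s x) = c * μ.simpleIntegral s := by
  have hg : ∀ x, s x ∈ hs.toFinset := fun x => by simp
  have h1 := μ.simpleIntegral_comp _ s hg (fun p => c * p)
  have h2 := μ.simpleIntegral_comp _ s hg (fun p => p)
  change μ.simpleIntegral s = _ at h2
  rw [h1, h2, Finset.mul_sum]
  exact Finset.sum_congr rfl fun p _ => mul_assoc _ _ _

theorem abs_simpleIntegral_sub_le (μ : BA S) (s t : S → ℝ) (hs : (Set.range s).Finite)
    (ht : (Set.range t).Finite) {ε : ℝ} (h : ∀ x, |s x - t x| ≤ ε) (hε : 0 ≤ ε) :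
    |μ.simpleIntegral s - μ.simpleIntegral t| ≤ ε * ‖μ‖ := by
  classical
  have h0 : μ ∅ = 0 := μ.empty'
  have hg : ∀ x, (s x, t x) ∈ hs.toFinset ×ˢ ht.toFinset := fun x => by simp
  have h2 := μ.simpleIntegral_comp _ (fun x => (s x, t x)) hg (fun p => p.1)
  have h3 := μ.simpleIntegral_comp _ (fun x => (s x, t x)) hg (fun p => p.2)
  change μ.simpleIntegral s = _ at h2
  change μ.simpleIntegral t = _ at h3
  rw [h2, h3, ← Finset.sum_sub_distrib]
  refine (Finset.abs_sum_le_sum_abs _ _).trans ?_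
  have hle : ∀ p ∈ hs.toFinset ×ˢ ht.toFinset,
      |p.1 * μ ((fun x => (s x, t x)) ⁻¹' {p}) - p.2 * μ ((fun x => (s x, t x)) ⁻¹' {p})|
        ≤ ε * |μ ((fun x => (s x, t x)) ⁻¹' {p})| := by
    intro p _
    rw [← sub_mul, abs_mul]
    rcases ((fun x => (s x, t x)) ⁻¹' {p}).eq_empty_or_nonempty with hE | ⟨x, hx⟩
    · simp [hE, h0]
    · refine mul_le_mul_of_nonneg_right ?_ (abs_nonneg _)
      have hx' : (s x, t x) = p := hx
      rw [← hx']
      exact h x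
  refine (Finset.sum_le_sum hle).trans ?_
  rw [← Finset.mul_sum]
  refine mul_le_mul_of_nonneg_left (μ.sum_abs_le_norm _ _ ?_) hε
  intro i _ j _ hij
  rw [Function.onFun, Set.disjoint_left]
  rintro x hx hx'
  exact hij (hx.symm.trans hx')

theorem abs_sub_approx_le (n : ℕ) (f : S → ℝ) (x : S) :
    |f x - approx n f x| ≤ 1 / ((n : ℝ) + 1) := by
  have hn : (0 : ℝ) < (n : ℝ) + 1 := by positivity
  have h1 := Int.floor_le (((n : ℝ) + 1) * f x)
  have h2 := (Int.lt_floor_add_one (((n : ℝ) + 1) * f x)).le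
  have : f x - approx n f x
      = (((n : ℝ) + 1) * f x - (⌊((n : ℝ) + 1) * f x⌋ : ℝ)) / ((n : ℝ) + 1) := by
    rw [approx]
    field_simp
  rw [this, abs_div, abs_of_pos hn]
  refine div_le_div_of_nonneg_right ?_ hn.le
  rw [abs_le]
  constructor <;> linarith

theorem approx_range_finite (n : ℕ) (f : S → ℝ) {C : ℝ} (hf : ∀ x, |f x| ≤ C) :
    (Set.range (approx n f)).Finite := by
  have hn : (0 : ℝ) < (n : ℝ) + 1 := by positivity
  refine ((Set.finite_Icc ⌊-(((n : ℝ) + 1) * C)⌋ ⌊((n : ℝ) + 1) * C⌋).image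
    (fun k : ℤ => (k : ℝ) / ((n : ℝ) + 1))).subset ?_
  rintro _ ⟨x, rfl⟩
  have h := abs_le.1 (hf x)
  refine ⟨⌊((n : ℝ) + 1) * f x⌋, ⟨Int.floor_le_floor ?_, Int.floor_le_floor ?_⟩, rfl⟩
  · nlinarith [h.1]
  · nlinarith [h.2]

theorem tendsto_simpleIntegral_approx (μ : BA S) (f : S → ℝ) {C : ℝ} (hf : ∀ x, |f x| ≤ C) :
    Filter.Tendsto (fun n : ℕ => μ.simpleIntegral (approx n f)) Filter.atTop
      (nhds (μ.integral f)) := by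
  have hcau : CauchySeq (fun n : ℕ => μ.simpleIntegral (approx n f)) := by
    refine cauchySeq_of_le_tendsto_0' (fun n : ℕ => (1 / ((n : ℝ) + 1) + 1 / ((n : ℝ) + 1)) * ‖μ‖)
      ?_ ?_
    · intro n m hnm
      rw [Real.dist_eq]
      refine μ.abs_simpleIntegral_sub_le _ _ (approx_range_finite n f hf)
        (approx_range_finite m f hf) (fun x => ?_) (by positivity)
      have h1 := abs_sub_approx_le n f x
      have h2 := abs_sub_approx_le m f x
      have h3 : 1 / ((m : ℝ) + 1) ≤ 1 / ((n : ℝ) + 1) :=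
        one_div_le_one_div_of_le (by positivity) (by exact_mod_cast Nat.add_le_add_right hnm 1)
      rw [abs_le] at h1 h2 ⊢
      constructor <;> linarith [h1.1, h1.2, h2.1, h2.2]
    · have h := tendsto_one_div_add_atTop_nhds_zero_nat (𝕜 := ℝ)
      simpa using (h.add h).mul_const ‖μ‖
  exact hcau.tendsto_limUnder

theorem abs_integral_sub_simpleIntegral_le (μ : BA S) (f : S → ℝ) {C : ℝ} (hf : ∀ x, |f x| ≤ C)
    (s : S → ℝ) (hs : (Set.range s).Finite) {ε : ℝ} (hε : 0 ≤ ε) (h : ∀ x, |f x - s x| ≤ ε) :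
    |μ.integral f - μ.simpleIntegral s| ≤ ε * ‖μ‖ := by
  have h1 := ((μ.tendsto_simpleIntegral_approx f hf).sub_const (μ.simpleIntegral s)).abs
  have h2 : Filter.Tendsto (fun n : ℕ => (ε + 1 / ((n : ℝ) + 1)) * ‖μ‖) Filter.atTop
      (nhds (ε * ‖μ‖)) := by
    simpa using ((tendsto_one_div_add_atTop_nhds_zero_nat (𝕜 := ℝ)).const_add ε).mul_const ‖μ‖
  refine le_of_tendsto_of_tendsto' h1 h2 fun n => ?_
  refine μ.abs_simpleIntegral_sub_le _ _ (approx_range_finite n f hf) hs (fun x => ?_)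
    (by positivity)
  have h3 := abs_sub_approx_le n f x
  have h4 := h x
  rw [abs_le] at h3 h4 ⊢
  constructor <;> linarith [h3.1, h3.2, h4.1, h4.2]

theorem abs_integral_le (μ : BA S) (f : S → ℝ) {C : ℝ} (hC : 0 ≤ C) (hf : ∀ x, |f x| ≤ C) :
    |μ.integral f| ≤ C * ‖μ‖ := by
  have h0 : μ.simpleIntegral (fun _ => (0 : ℝ)) = 0 := by
    have := μ.simpleIntegral_comp {(0 : ℝ)} (fun _ => (0 : ℝ)) (by simp) (fun p => p)
    simpa using this
  have hfin : (Set.range (fun _ : S => (0 : ℝ))).Finite :=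
    (Set.finite_singleton (0 : ℝ)).subset (by rintro _ ⟨x, rfl⟩; simp)
  simpa [h0] using μ.abs_integral_sub_simpleIntegral_le f hf (fun _ => 0) hfin hC (by simpa using hf)

theorem integral_add (μ : BA S) (f g : S → ℝ) {C D : ℝ} (hf : ∀ x, |f x| ≤ C)
    (hg : ∀ x, |g x| ≤ D) :
    μ.integral (fun x => f x + g x) = μ.integral f + μ.integral g := by
  have hfg : ∀ x, |f x + g x| ≤ C + D := fun x => (abs_add_le _ _).trans (add_le_add (hf x) (hg x))
  refine tendsto_nhds_unique ?_ ((μ.tendsto_simpleIntegral_approx f hf).add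
    (μ.tendsto_simpleIntegral_approx g hg))
  rw [tendsto_iff_dist_tendsto_zero]
  have h2 : Filter.Tendsto (fun n : ℕ => (1 / ((n : ℝ) + 1) + 1 / ((n : ℝ) + 1)) * ‖μ‖)
      Filter.atTop (nhds 0) := by
    have h := tendsto_one_div_add_atTop_nhds_zero_nat (𝕜 := ℝ)
    simpa using (h.add h).mul_const ‖μ‖
  refine squeeze_zero (fun _ => dist_nonneg) (fun n => ?_) h2
  have hf' := approx_range_finite n f hf
  have hg' := approx_range_finite n g hg
  rw [← μ.simpleIntegral_add _ _ hf' hg', dist_comm, Real.dist_eq]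
  refine μ.abs_integral_sub_simpleIntegral_le _ hfg _ ?_ (by positivity) fun x => ?_
  · refine ((hf'.prod hg').image (fun p : ℝ × ℝ => p.1 + p.2)).subset ?_
    rintro _ ⟨x, rfl⟩
    exact ⟨(approx n f x, approx n g x), ⟨⟨x, rfl⟩, ⟨x, rfl⟩⟩, rfl⟩
  · have h3 := abs_sub_approx_le n f x
    have h4 := abs_sub_approx_le n g x
    rw [abs_le] at h3 h4 ⊢
    constructor <;> linarith [h3.1, h3.2, h4.1, h4.2]

theorem integral_smul (μ : BA S) (c : ℝ) (f : S → ℝ) {C : ℝ} (hf : ∀ x, |f x| ≤ C) :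
    μ.integral (fun x => c * f x) = c * μ.integral f := by
  have hcf : ∀ x, |c * f x| ≤ |c| * C := fun x => by
    rw [abs_mul]
    exact mul_le_mul_of_nonneg_left (hf x) (abs_nonneg c)
  refine tendsto_nhds_unique ?_ ((μ.tendsto_simpleIntegral_approx f hf).const_mul c)
  rw [tendsto_iff_dist_tendsto_zero]
  have h2 : Filter.Tendsto (fun n : ℕ => (|c| * (1 / ((n : ℝ) + 1))) * ‖μ‖)
      Filter.atTop (nhds 0) := by
    have h := tendsto_one_div_add_atTop_nhds_zero_nat (𝕜 := ℝ)
    simpa using (h.const_mul |c|).mul_const ‖μ‖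
  refine squeeze_zero (fun _ => dist_nonneg) (fun n => ?_) h2
  have hf' := approx_range_finite n f hf
  rw [← μ.simpleIntegral_smul c _ hf', dist_comm, Real.dist_eq]
  refine μ.abs_integral_sub_simpleIntegral_le _ hcf _ ?_ (by positivity) fun x => ?_
  · refine (hf'.image (fun r : ℝ => c * r)).subset ?_
    rintro _ ⟨x, rfl⟩
    exact ⟨approx n f x, ⟨x, rfl⟩, rfl⟩
  · rw [← mul_sub, abs_mul]
    exact mul_le_mul_of_nonneg_left (abs_sub_approx_le n f x) (abs_nonneg c)

end BA

/-! ### The space of Lipschitz functions that vanish at the base point -/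

/-- The linear space of all Lipschitz functions on `M` that vanish at the base point `o`. -/
def lip0Submodule (M : Type*) [MetricSpace M] (o : M) : Submodule ℝ (M → ℝ) where
  carrier := {f | (∃ K : NNReal, LipschitzWith K f) ∧ f o = 0}
  add_mem' := by
    rintro f g ⟨⟨K, hK⟩, hf⟩ ⟨⟨L, hL⟩, hg⟩
    exact ⟨⟨K + L, hK.add hL⟩, by simp [hf, hg]⟩
  zero_mem' := ⟨⟨0, LipschitzWith.const 0⟩, rfl⟩
  smul_mem' := by
    rintro c f ⟨⟨K, hK⟩, hf⟩
    refine ⟨⟨‖c‖₊ * K, LipschitzWith.of_dist_le_mul fun x y => ?_⟩, by simp [hf]⟩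
    have h := hK.dist_le_mul x y
    rw [Real.dist_eq] at h ⊢
    simp only [Pi.smul_apply, smul_eq_mul, ← mul_sub, abs_mul, NNReal.coe_mul, coe_nnnorm,
      Real.norm_eq_abs, mul_assoc]
    exact mul_le_mul_of_nonneg_left h (abs_nonneg c)

/-- The space `Lip₀(M)` for the metric space `M` with base point `o`. It is a type of its own,
so that its topology is that of the Lipschitz norm and not that of pointwise convergence. -/
def Lip0 (M : Type*) [MetricSpace M] (o : M) : Type _ := lip0Submodule M o

/-- The set of all pairs of distinct points of `M`. -/
abbrev OffDiag (M : Type*) : Type _ := {p : M × M // p.1 ≠ p.2}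

namespace Lip0

variable {M : Type*} [MetricSpace M] {o : M}

instance : AddCommGroup (Lip0 M o) := inferInstanceAs (AddCommGroup (lip0Submodule M o))

instance : Module ℝ (Lip0 M o) := inferInstanceAs (Module ℝ (lip0Submodule M o))

instance : CoeFun (Lip0 M o) (fun _ => M → ℝ) := ⟨fun f => f.1⟩

/-- The norm of `f` is the supremum of `|f x - f y| / d(x, y)` over all pairs `x ≠ y`. -/
instance : Norm (Lip0 M o) :=
  ⟨fun f => ⨆ p : OffDiag M, |f p.1.1 - f p.1.2| / dist p.1.1 p.1.2⟩

/-- The de Leeuw transform `(x, y) ↦ (f x - f y) / d(x, y)` of `f`. -/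
def deLeeuw (f : Lip0 M o) : OffDiag M → ℝ := fun p => (f p.1.1 - f p.1.2) / dist p.1.1 p.1.2

theorem bddAbove_slopes (f : Lip0 M o) :
    BddAbove (Set.range fun p : OffDiag M => |f p.1.1 - f p.1.2| / dist p.1.1 p.1.2) := by
  obtain ⟨⟨K, hK⟩, -⟩ := f.2
  refine ⟨K, ?_⟩
  rintro _ ⟨p, rfl⟩
  refine div_le_of_le_mul₀ dist_nonneg K.2 ?_
  simpa [Real.dist_eq] using hK.dist_le_mul p.1.1 p.1.2

theorem abs_deLeeuw_le (f : Lip0 M o) (p : OffDiag M) : |f.deLeeuw p| ≤ ‖f‖ := by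
  have h := le_ciSup f.bddAbove_slopes p
  rwa [deLeeuw, abs_div, abs_of_nonneg (dist_nonneg (x := p.1.1) (y := p.1.2))]

theorem norm_nonneg' (f : Lip0 M o) : 0 ≤ ‖f‖ :=
  Real.iSup_nonneg fun _ => div_nonneg (abs_nonneg _) dist_nonneg

theorem norm_le_of_forall (f : Lip0 M o) {C : ℝ} (hC : 0 ≤ C)
    (h : ∀ p : OffDiag M, |f.deLeeuw p| ≤ C) : ‖f‖ ≤ C := by
  refine Real.iSup_le (fun p => ?_) hC
  have := h p
  rwa [deLeeuw, abs_div, abs_of_nonneg (dist_nonneg (x := p.1.1) (y := p.1.2))] at this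

theorem deLeeuw_add (f g : Lip0 M o) : (f + g).deLeeuw = fun p => f.deLeeuw p + g.deLeeuw p := by
  funext p
  change ((f p.1.1 + g p.1.1) - (f p.1.2 + g p.1.2)) / _ = _ / _ + _ / _
  ring

theorem deLeeuw_smul (c : ℝ) (f : Lip0 M o) : (c • f).deLeeuw = fun p => c * f.deLeeuw p := by
  funext p
  change (c * f p.1.1 - c * f p.1.2) / _ = c * (_ / _)
  ring

theorem core : NormedSpace.Core ℝ (Lip0 M o) where
  norm_nonneg f := f.norm_nonneg'
  norm_smul c f := by
    refine le_antisymm ?_ ?_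
    · refine norm_le_of_forall _ (mul_nonneg (norm_nonneg c) f.norm_nonneg') fun p => ?_
      rw [deLeeuw_smul, abs_mul]
      exact mul_le_mul_of_nonneg_left (f.abs_deLeeuw_le p) (abs_nonneg c)
    · by_cases hc : c = 0
      · simp only [hc, norm_zero, zero_mul]
        exact norm_nonneg' _
      · have hc' : 0 < ‖c‖ := norm_pos_iff.2 hc
        rw [mul_comm, ← le_div_iff₀ hc']
        refine norm_le_of_forall _ (div_nonneg (norm_nonneg' _) hc'.le) fun p => ?_
        rw [le_div_iff₀ hc', mul_comm]
        have := (c • f).abs_deLeeuw_le p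
        rwa [deLeeuw_smul, abs_mul] at this
  norm_triangle f g := by
    refine norm_le_of_forall _ (add_nonneg f.norm_nonneg' g.norm_nonneg') fun p => ?_
    rw [deLeeuw_add]
    exact (abs_add_le _ _).trans (add_le_add (f.abs_deLeeuw_le p) (g.abs_deLeeuw_le p))
  norm_eq_zero_iff f := by
    constructor
    · intro h
      apply Subtype.ext
      funext x
      have h0 : f o = 0 := f.2.2
      change f x = 0
      by_cases hx : x = o
      · rw [hx, h0]
      · have h1 := f.abs_deLeeuw_le ⟨(x, o), hx⟩
        rw [h] at h1
        have h2 : (f x - f o) / dist x o = 0 := abs_nonpos_iff.1 h1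
        rcases div_eq_zero_iff.1 h2 with h3 | h3
        · linarith
        · exact absurd (dist_eq_zero.1 h3) hx
    · rintro rfl
      refine le_antisymm (norm_le_of_forall _ le_rfl fun p => ?_) (norm_nonneg' _)
      change |((0 : ℝ) - 0) / _| ≤ 0
      simp

instance : NormedAddCommGroup (Lip0 M o) := NormedAddCommGroup.ofCore core

instance : NormedSpace ℝ (Lip0 M o) := NormedSpace.ofCore core

end Lip0

/-- The functional `Φ^*μ` on `Lip₀(M)`, that is `f ↦ ∫ (f x - f y) / d(x, y) dμ(x, y)`. -/
def adjointDeLeeuw {M : Type*} [MetricSpace M] (o : M) (μ : BA (OffDiag M)) :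
    StrongDual ℝ (Lip0 M o) :=
  LinearMap.mkContinuous
    { toFun := fun f => μ.integral f.deLeeuw
      map_add' := fun f g => by
        rw [Lip0.deLeeuw_add]
        exact μ.integral_add _ _ f.abs_deLeeuw_le g.abs_deLeeuw_le
      map_smul' := fun c f => by
        rw [Lip0.deLeeuw_smul]
        exact μ.integral_smul c _ f.abs_deLeeuw_le }
    ‖μ‖ (fun f => by
      rw [mul_comm]
      exact μ.abs_integral_le _ f.norm_nonneg' f.abs_deLeeuw_le)

/-- A bounded finitely additive measure `μ` on the off-diagonal pairs is optimal if it is positive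
and `‖Φ^*μ‖ = ‖μ‖`. -/
def IsOptimal {M : Type*} [MetricSpace M] (o : M) (μ : BA (OffDiag M)) : Prop :=
  μ.IsPositive ∧ ‖adjointDeLeeuw o μ‖ = ‖μ‖

/-- `γ`-cyclic monotonicity of a set `A` of pairs of distinct points: for each finite sequence
`(x_0, y_0), …, (x_n, y_n)` in `A`,
`∑ i, min (d(x_i, y_{i+1}) - γ * d(x_i, y_i)) (d(y_i, y_{i+1})) ≥ 0`, where `y_{n+1} = y_0`
(the addition `i + 1` in `Fin (n + 1)` is cyclic). -/
def IsCyclicallyMonotonic {M : Type*} [MetricSpace M] (γ : ℝ) (A : Set (OffDiag M)) : Prop :=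
  ∀ (n : ℕ) (p : Fin (n + 1) → OffDiag M), (∀ i, p i ∈ A) →
    0 ≤ ∑ i, min (dist (p i).1.1 (p (i + 1)).1.2 - γ * dist (p i).1.1 (p i).1.2)
      (dist (p i).1.2 (p (i + 1)).1.2)

end

/-! Both conditions reduce to statements about slopes of functions in the unit ball of `Lip0 M o`.
By Hahn–Banach, every functional of norm one is `Φ^*μ` for an optimal `μ` of norm one
(`exists_isOptimal_of_norm_eq_one`), so optimal measures describe all slices. For a function in the
unit ball, a value of `Φ^*μ` close to 1 means slopes close to 1 outside a set of small `μ`-measure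
(`IsOptimal.apply_slopes_lt`, `IsOptimal.le_adjointDeLeeuw`). As in Rockafellar's theorem on
potentials, a set is `γ`-cyclically monotonic exactly when some function in the unit ball has slopes
at least `γ` on it (`isCyclicallyMonotonic_of_deLeeuw`, `IsCyclicallyMonotonic.exists_lip0`).

If equal-weight averages of functions `f i` and `g i` from the slices are almost 2 apart, some pair
`(u, v)` witnesses this, and there every `f i` has slope near 1 and every `g i` slope near -1
(`exists_opposite_slopes`). The sets where `f i` and `g i` are both steep serve as `A i`.
Conversely, potentials of `A i ∪ {(u, v)}` and `A i ∪ {(v, u)}` lie in the `i`-th slice once `γ` is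
close to 1. Since `(u, v)` does not depend on `i`, their convex combinations are at least `2 * γ`
apart, and `γ → 1`. -/

noncomputable section

/-! ### Positive finitely additive measures and their integrals -/

namespace BA

variable {S : Type*}

theorem apply_union (μ : BA S) {A B : Set S} (h : Disjoint A B) : μ (A ∪ B) = μ A + μ B :=
  MeasureTheory.addContent_union' (m := μ.toAddContent) (Set.mem_univ _) (Set.mem_univ _)
    (Set.mem_univ _) h

theorem apply_add_compl (μ : BA S) (A : Set S) : μ A + μ Aᶜ = μ Set.univ := by
  rw [← μ.apply_union disjoint_compl_right, Set.union_compl_self]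

theorem IsPositive.mono {μ : BA S} (hμ : μ.IsPositive) {A B : Set S} (h : A ⊆ B) : μ A ≤ μ B := by
  have h1 := μ.apply_union (A := A) (B := B \ A) Set.disjoint_sdiff_right
  rw [Set.union_sdiff_cancel h] at h1
  linarith [hμ (B \ A)]

theorem IsPositive.union_le {μ : BA S} (hμ : μ.IsPositive) (A B : Set S) :
    μ (A ∪ B) ≤ μ A + μ B := by
  rw [← Set.union_sdiff_self, μ.apply_union Set.disjoint_sdiff_right]
  linarith [hμ.mono (Set.sdiff_subset : B \ A ⊆ B)]

theorem IsPositive.norm_eq {μ : BA S} (hμ : μ.IsPositive) : ‖μ‖ = μ Set.univ := by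
  refine le_antisymm (csSup_le ⟨0, ∅, by simp, by simp, by simp⟩ ?_) ?_
  · rintro r ⟨P, hP, -, rfl⟩
    rw [Finset.sum_congr rfl fun B _ => abs_of_nonneg (hμ B),
      ← μ.sUnion' P (Set.subset_univ _) hP (Set.mem_univ _)]
    exact hμ.mono (Set.subset_univ _)
  · have h := μ.sum_abs_le_norm {()} (fun _ => Set.univ) (by simp)
    simpa using (le_abs_self _).trans (by simpa using h)

theorem IsPositive.integral_nonneg {μ : BA S} (hμ : μ.IsPositive) {f : S → ℝ} {C : ℝ}
    (hf : ∀ x, |f x| ≤ C) (h : ∀ x, 0 ≤ f x) : 0 ≤ μ.integral f := by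
  refine ge_of_tendsto' (μ.tendsto_simpleIntegral_approx f hf) fun n => finsum_nonneg fun c => ?_
  -- Only attained values `c` contribute, and rounding down to a multiple of `1 / (n + 1)` keeps
  -- nonnegative values nonnegative.
  rcases (approx n f ⁻¹' {c}).eq_empty_or_nonempty with hE | ⟨x, hx⟩
  · have h0 : μ ∅ = 0 := μ.empty'
    simp [hE, h0]
  · refine mul_nonneg ?_ (hμ _)
    have hx' : approx n f x = c := hx
    rw [← hx']
    refine div_nonneg ?_ (by positivity)
    exact_mod_cast Int.floor_nonneg.2 (mul_nonneg (by positivity) (h x))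

theorem IsPositive.integral_mono {μ : BA S} (hμ : μ.IsPositive) {f g : S → ℝ} {C D : ℝ}
    (hf : ∀ x, |f x| ≤ C) (hg : ∀ x, |g x| ≤ D) (h : ∀ x, f x ≤ g x) :
    μ.integral f ≤ μ.integral g := by
  have hf' : ∀ x, |(-1) * f x| ≤ C := fun x => by simpa using hf x
  have hgf : ∀ x, |g x + (-1) * f x| ≤ D + C :=
    fun x => (abs_add_le _ _).trans (add_le_add (hg x) (hf' x))
  have h1 := hμ.integral_nonneg hgf fun x => by linarith [h x]
  rw [μ.integral_add _ _ hg hf', μ.integral_smul _ _ hf] at h1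
  linarith

open Classical in
theorem integral_ite (μ : BA S) (A : Set S) (a b : ℝ) :
    μ.integral (fun x => if x ∈ A then a else b) = a * μ A + b * μ Aᶜ := by
  have hfin : (Set.range fun x => if x ∈ A then a else b).Finite := by
    refine (Set.toFinite {a, b}).subset ?_
    rintro _ ⟨x, rfl⟩
    by_cases hx : x ∈ A <;> simp [hx]
  have hb : ∀ x, |if x ∈ A then a else b| ≤ max |a| |b| := fun x => by
    by_cases hx : x ∈ A <;> simp [hx]
  -- The function is its own approximation, with error `ε = 0`.
  have h1 := μ.abs_integral_sub_simpleIntegral_le _ hb _ hfin le_rfl (by simp)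
  rw [zero_mul] at h1
  rw [sub_eq_zero.1 (abs_nonpos_iff.1 h1)]
  -- Summing over `Bool` rather than over the values avoids a separate case `a = b`.
  have h2 := μ.simpleIntegral_comp Finset.univ (fun x => decide (x ∈ A)) (fun _ => Finset.mem_univ _)
    (fun t : Bool => if t then a else b)
  have h3 : (fun x => decide (x ∈ A)) ⁻¹' {true} = A := by ext; simp
  have h4 : (fun x => decide (x ∈ A)) ⁻¹' {false} = Aᶜ := by ext; simp
  simpa [h3, h4] using h2

theorem IsPositive.le_integral {μ : BA S} (hμ : μ.IsPositive) {f : S → ℝ} {C a b : ℝ}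
    (hf : ∀ x, |f x| ≤ C) (A : Set S) (ha : ∀ x ∈ A, a ≤ f x) (hb : ∀ x ∉ A, b ≤ f x) :
    a * μ A + b * μ Aᶜ ≤ μ.integral f := by
  classical
  rw [← integral_ite]
  refine hμ.integral_mono (C := max |a| |b|) (fun x => ?_) hf fun x => ?_ <;>
  by_cases hx : x ∈ A <;> simp [hx, ha, hb]

theorem IsPositive.integral_le {μ : BA S} (hμ : μ.IsPositive) {f : S → ℝ} {C a b : ℝ}
    (hf : ∀ x, |f x| ≤ C) (A : Set S) (ha : ∀ x ∈ A, f x ≤ a) (hb : ∀ x ∉ A, f x ≤ b) :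
    μ.integral f ≤ a * μ A + b * μ Aᶜ := by
  classical
  rw [← integral_ite]
  refine hμ.integral_mono (D := max |a| |b|) hf (fun x => ?_) fun x => ?_ <;>
  by_cases hx : x ∈ A <;> simp [hx, ha, hb]

/-! ### Positive functionals on bounded functions as measures -/

/-- The space of bounded real functions on `S`. -/
def boundedFunctions (S : Type*) : Submodule ℝ (S → ℝ) where
  carrier := {f | ∃ C, ∀ x, |f x| ≤ C}
  add_mem' := by
    rintro f g ⟨C, hC⟩ ⟨D, hD⟩
    exact ⟨C + D, fun x => (abs_add_le _ _).trans (add_le_add (hC x) (hD x))⟩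
  zero_mem' := ⟨0, by simp⟩
  smul_mem' := by
    rintro c f ⟨C, hC⟩
    refine ⟨|c| * C, fun x => ?_⟩
    simp only [Pi.smul_apply, smul_eq_mul, abs_mul]
    exact mul_le_mul_of_nonneg_left (hC x) (abs_nonneg c)

theorem boundedFunctions.bddAbove (f : boundedFunctions S) : BddAbove (Set.range f.1) := by
  obtain ⟨C, hC⟩ := f.2
  exact ⟨C, by rintro _ ⟨x, rfl⟩; exact (abs_le.1 (hC x)).2⟩

/-- The indicator function of a set as a bounded function. -/
def boundedIndicator (A : Set S) : boundedFunctions S :=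
  ⟨A.indicator 1, 1, fun x => by by_cases hx : x ∈ A <;> simp [hx]⟩

theorem boundedIndicator_sUnion (P : Finset (Set S)) (hP : (P : Set (Set S)).PairwiseDisjoint id) :
    boundedIndicator (⋃₀ (P : Set (Set S))) = ∑ B ∈ P, boundedIndicator B := by
  apply Subtype.ext
  rw [AddSubmonoidClass.coe_finsetSum, Set.sUnion_eq_biUnion]
  funext x
  rw [Finset.sum_apply]
  exact Finset.indicator_biUnion_apply P (fun B => B) (f := 1) hP x

/-- The finitely additive measure that represents a positive linear functional on the bounded
functions. -/
def ofLinear (G : boundedFunctions S →ₗ[ℝ] ℝ) (hG : ∀ f : boundedFunctions S, 0 ≤ f.1 → 0 ≤ G f) :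
    BA S where
  toFun A := G (boundedIndicator A)
  empty' := by
    rw [show boundedIndicator (∅ : Set S) = 0 from Subtype.ext (Set.indicator_empty _), map_zero]
  sUnion' P _ hP _ := by rw [boundedIndicator_sUnion P hP, map_sum]
  bounded' := by
    refine ⟨G (boundedIndicator Set.univ), fun A => ?_⟩
    rw [abs_of_nonneg (hG _ (Set.indicator_nonneg (by simp)))]
    rw [← sub_nonneg, ← map_sub]
    refine hG _ fun x => ?_
    by_cases hx : x ∈ A <;> simp [boundedIndicator, hx]

theorem simpleIntegral_ofLinear (G : boundedFunctions S →ₗ[ℝ] ℝ)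
    (hG : ∀ f : boundedFunctions S, 0 ≤ f.1 → 0 ≤ G f) (s : boundedFunctions S)
    (hs : (Set.range s.1).Finite) : (ofLinear G hG).simpleIntegral s.1 = G s := by
  classical
  have h := (ofLinear G hG).simpleIntegral_comp hs.toFinset s.1 (by simp) (fun c => c)
  change (ofLinear G hG).simpleIntegral s.1 = _ at h
  have h2 : s = ∑ c ∈ hs.toFinset, c • boundedIndicator (s.1 ⁻¹' {c}) := by
    apply Subtype.ext
    rw [AddSubmonoidClass.coe_finsetSum]
    funext x
    rw [Finset.sum_apply, Finset.sum_eq_single (s.1 x)]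
    · simp [boundedIndicator]
    · intro c _ hc
      simp [boundedIndicator, hc.symm]
    · intro hx
      simp at hx
  rw [h]
  conv_rhs => rw [h2]
  rw [map_sum]
  refine Finset.sum_congr rfl fun c _ => ?_
  rw [map_smul]
  rfl

/-- Positivity makes `G` monotone, hence continuous for uniform convergence, so the identity passes
from functions with finitely many values to their uniform limits. -/
theorem integral_ofLinear (G : boundedFunctions S →ₗ[ℝ] ℝ)
    (hG : ∀ f : boundedFunctions S, 0 ≤ f.1 → 0 ≤ G f) (f : boundedFunctions S) :
    (ofLinear G hG).integral f.1 = G f := by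
  obtain ⟨C, hC⟩ := f.2
  have hb : ∀ n, approx n f.1 ∈ boundedFunctions S := fun n => by
    refine ⟨C + 1 / ((n : ℝ) + 1), fun x => ?_⟩
    have h1 := abs_le.1 (abs_sub_approx_le n f.1 x)
    have h2 := abs_le.1 (hC x)
    rw [abs_le]
    constructor <;> linarith [h1.1, h1.2, h2.1, h2.2]
  refine tendsto_nhds_unique ((ofLinear G hG).tendsto_simpleIntegral_approx f.1 hC) ?_
  rw [tendsto_iff_dist_tendsto_zero]
  have hlim : Filter.Tendsto (fun n : ℕ => 1 / ((n : ℝ) + 1) * G (boundedIndicator Set.univ))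
      Filter.atTop (nhds 0) := by
    simpa using (tendsto_one_div_add_atTop_nhds_zero_nat (𝕜 := ℝ)).mul_const
      (G (boundedIndicator Set.univ))
  refine squeeze_zero (fun _ => dist_nonneg) (fun n => ?_) hlim
  rw [simpleIntegral_ofLinear G hG ⟨approx n f.1, hb n⟩ (approx_range_finite n f.1 hC),
    Real.dist_eq]
  have key : ∀ g h : boundedFunctions S, (∀ x, g.1 x - h.1 x ≤ 1 / ((n : ℝ) + 1)) →
      G g - G h ≤ 1 / ((n : ℝ) + 1) * G (boundedIndicator Set.univ) := by
    intro g h hgh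
    rw [← smul_eq_mul, ← map_smul, ← map_sub, ← sub_nonneg, ← map_sub]
    refine hG _ fun x => ?_
    simpa [boundedIndicator] using hgh x
  have h1 := fun x => abs_le.1 (abs_sub_approx_le n f.1 x)
  rw [abs_le]
  constructor
  · have := key f ⟨approx n f.1, hb n⟩ fun x => (h1 x).2
    linarith
  · exact key ⟨approx n f.1, hb n⟩ f fun x => by linarith [(h1 x).1]

end BA

/-! ### Slopes of functions in the unit ball -/

namespace Lip0

variable {M : Type*} [MetricSpace M] {o : M}

/-- A real function with `|f x - f y| ≤ d(x, y)`, translated so that it vanishes at `o`. -/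
def ofLipschitz (o : M) (f : M → ℝ) (hf : ∀ x y, f x - f y ≤ dist x y) : Lip0 M o :=
  ⟨fun x => f x - f o, ⟨1, LipschitzWith.of_dist_le_mul fun x y => by
    rw [Real.dist_eq, abs_le, NNReal.coe_one, one_mul]
    have h1 := hf x y
    have h2 := hf y x
    rw [dist_comm] at h2
    constructor <;> linarith⟩, sub_self _⟩

theorem deLeeuw_ofLipschitz (f : M → ℝ) (hf : ∀ x y, f x - f y ≤ dist x y) (p : OffDiag M) :
    (ofLipschitz o f hf).deLeeuw p = (f p.1.1 - f p.1.2) / dist p.1.1 p.1.2 := by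
  change ((f p.1.1 - f o) - (f p.1.2 - f o)) / _ = _
  ring

theorem dist_pos_of_offDiag (p : OffDiag M) : 0 < dist p.1.1 p.1.2 := dist_pos.2 p.2

theorem norm_ofLipschitz_le (f : M → ℝ) (hf : ∀ x y, f x - f y ≤ dist x y) :
    ‖ofLipschitz o f hf‖ ≤ 1 := by
  refine norm_le_of_forall _ zero_le_one fun p => ?_
  have hp := dist_pos_of_offDiag p
  rw [deLeeuw_ofLipschitz, abs_div, abs_of_pos hp, div_le_one hp, abs_le]
  have h1 := hf p.1.1 p.1.2
  have h2 := hf p.1.2 p.1.1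
  rw [dist_comm] at h2
  constructor <;> linarith

/-- The opposite pair `(y, x)` of a pair `(x, y)`. -/
def swapPair (p : OffDiag M) : OffDiag M := ⟨(p.1.2, p.1.1), p.2.symm⟩

theorem deLeeuw_swapPair (f : Lip0 M o) (p : OffDiag M) : f.deLeeuw (swapPair p) = -f.deLeeuw p := by
  change (f p.1.2 - f p.1.1) / dist p.1.2 p.1.1 = -((f p.1.1 - f p.1.2) / dist p.1.1 p.1.2)
  rw [dist_comm]
  ring

theorem sub_le_dist (f : Lip0 M o) (hf : ‖f‖ ≤ 1) (x y : M) : f x - f y ≤ dist x y := by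
  by_cases h : x = y
  · simp [h]
  · have h1 := (le_abs_self _).trans ((f.abs_deLeeuw_le ⟨(x, y), h⟩).trans hf)
    rwa [deLeeuw, div_le_one (dist_pos.2 h)] at h1

end Lip0

/-! ### Cyclic monotonicity and potentials -/

section CyclicMonotonicity

variable {M : Type*} [MetricSpace M]

/-- The function whose sums along cycles define `γ`-cyclic monotonicity. -/
def transportCost (γ : ℝ) (p : OffDiag M) (z : M) : ℝ :=
  min (dist p.1.1 z - γ * dist p.1.1 p.1.2) (dist p.1.2 z)

/-- Each branch of the minimum is a distance to the endpoint up to a constant. This makes the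
potential built from path costs 1-Lipschitz. -/
theorem transportCost_le_add_dist (γ : ℝ) (p : OffDiag M) (z w : M) :
    transportCost γ p z ≤ transportCost γ p w + dist z w := by
  have h1 := dist_triangle p.1.1 w z
  have h2 := dist_triangle p.1.2 w z
  rw [dist_comm w z] at h1 h2
  rw [transportCost, transportCost, min_add]
  exact min_le_min (by linarith) (by linarith)

/-- The `i`-th term of the cyclic sum is at least `f y_i - f y_{i+1}`, by the Lipschitz bound and
the slope at `(x_i, y_i)`. These differences cancel around the cycle. -/
theorem isCyclicallyMonotonic_of_deLeeuw {o : M} {γ : ℝ} {A : Set (OffDiag M)} (f : Lip0 M o)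
    (hf : ‖f‖ ≤ 1) (hA : ∀ p ∈ A, γ ≤ f.deLeeuw p) : IsCyclicallyMonotonic γ A := by
  intro n p hp
  have h0 : ∑ i, (f (p i).1.2 - f (p (i + 1)).1.2) = 0 := by
    rw [Finset.sum_sub_distrib, sub_eq_zero]
    exact (Equiv.sum_comp (Equiv.addRight (1 : Fin (n + 1))) fun i => f (p i).1.2).symm
  rw [← h0]
  refine Finset.sum_le_sum fun i _ => le_min ?_ (f.sub_le_dist hf _ _)
  have h1 := hA _ (hp i)
  rw [Lip0.deLeeuw, le_div_iff₀ (Lip0.dist_pos_of_offDiag _)] at h1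
  have h2 := f.sub_le_dist hf (p i).1.1 (p (i + 1)).1.2
  linarith

/-- The total cost of a finite path `p 0, …, p n` that ends at `z`. -/
def pathCost (γ : ℝ) (n : ℕ) (p : ℕ → OffDiag M) (z : M) : ℝ :=
  ∑ i ∈ Finset.range n, transportCost γ (p i) (p (i + 1)).1.2 + transportCost γ (p n) z

/-- A path ending at the second point of its first pair is a cycle. -/
theorem IsCyclicallyMonotonic.pathCost_nonneg {γ : ℝ} {A : Set (OffDiag M)}
    (hA : IsCyclicallyMonotonic γ A) (n : ℕ) (p : ℕ → OffDiag M) (hp : ∀ i, p i ∈ A) :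
    0 ≤ pathCost γ n p (p 0).1.2 := by
  have h := hA n (fun i => p i) fun i => hp i
  -- The last index is split off because only there does `i + 1` wrap around to 0.
  rw [Fin.sum_univ_castSucc] at h
  simp only [Fin.coeSucc_eq_succ, Fin.last_add_one, Fin.val_succ, Fin.val_castSucc, Fin.val_last,
    Fin.val_zero] at h
  rw [Fin.sum_univ_eq_sum_range (fun i => min (dist (p i).1.1 (p (i + 1)).1.2
    - γ * dist (p i).1.1 (p i).1.2) (dist (p i).1.2 (p (i + 1)).1.2))] at h
  exact h

theorem pathCost_extend (γ : ℝ) (n : ℕ) (p : ℕ → OffDiag M) (q : OffDiag M) (z : M) :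
    pathCost γ (n + 1) (fun i => if i ≤ n then p i else q) z
      = pathCost γ n p q.1.2 + transportCost γ q z := by
  rw [pathCost, pathCost, Finset.sum_range_succ]
  have h : ∀ i ∈ Finset.range n, transportCost γ (if i ≤ n then p i else q)
      (if i + 1 ≤ n then p (i + 1) else q).1.2 = transportCost γ (p i) (p (i + 1)).1.2 := by
    intro i hi
    have := Finset.mem_range.1 hi
    rw [if_pos (by omega), if_pos (by omega)]
  rw [Finset.sum_congr rfl h]
  simp

/-- A cyclically monotonic set is the set of almost maximal slopes of a function in the unit ball. -/
theorem IsCyclicallyMonotonic.exists_lip0 (o : M) {γ : ℝ} {A : Set (OffDiag M)}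
    (hA : IsCyclicallyMonotonic γ A) : ∃ f : Lip0 M o, ‖f‖ ≤ 1 ∧ ∀ p ∈ A, γ ≤ f.deLeeuw p := by
  rcases A.eq_empty_or_nonempty with rfl | ⟨q, hq⟩
  · exact ⟨0, by simp, by simp⟩
  -- The potential is the least cost of a path in `A` from the fixed pair `q`. With a common start,
  -- closing the path bounds the cost below.
  let I := {s : ℕ × (ℕ → OffDiag M) // s.2 0 = q ∧ ∀ i, s.2 i ∈ A}
  have : Nonempty I := ⟨⟨(0, fun _ => q), rfl, fun _ => hq⟩⟩
  let c : I → M → ℝ := fun s z => pathCost γ s.1.1 s.1.2 z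
  have hc : ∀ s z w, c s z ≤ c s w + dist z w := fun s z w => by
    have := transportCost_le_add_dist γ (s.1.2 s.1.1) z w
    simp only [c, pathCost]
    linarith
  have hbdd : ∀ z, BddBelow (Set.range fun s => c s z) := by
    refine fun z => ⟨-dist q.1.2 z, ?_⟩
    rintro _ ⟨s, rfl⟩
    have h1 := hA.pathCost_nonneg s.1.1 s.1.2 s.2.2
    rw [s.2.1] at h1
    have h2 := hc s q.1.2 z
    simp only [c] at h2 ⊢
    linarith
  let g : M → ℝ := fun z => ⨅ s, c s z
  have hg : ∀ z w, g z ≤ g w + dist z w := fun z w => by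
    rw [← sub_le_iff_le_add]
    refine le_ciInf fun s => ?_
    have h1 : g z ≤ c s z := ciInf_le (hbdd z) s
    linarith [hc s z w]
  have hlip : ∀ x y, -g x - -g y ≤ dist x y := fun x y => by
    have := hg y x
    rw [dist_comm] at this
    linarith
  refine ⟨Lip0.ofLipschitz o (fun x => -g x) hlip, Lip0.norm_ofLipschitz_le _ hlip, fun p hp => ?_⟩
  rw [Lip0.deLeeuw_ofLipschitz, le_div_iff₀ (Lip0.dist_pos_of_offDiag p)]
  have h1 : g p.1.1 + γ * dist p.1.1 p.1.2 ≤ g p.1.2 := by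
    refine le_ciInf fun s => ?_
    -- Appending `p` to a path that ends at `p.1.2` and stopping at `p.1.1` costs at most `-γ * dist
    -- p.1.1 p.1.2` more.
    have h2 : g p.1.1 ≤ c ⟨(s.1.1 + 1, fun i => if i ≤ s.1.1 then s.1.2 i else p),
        by simpa using s.2.1, fun i => by
          dsimp only
          split_ifs
          · exact s.2.2 i
          · exact hp⟩ p.1.1 := ciInf_le (hbdd _) _
    simp only [c] at h2 ⊢
    rw [pathCost_extend] at h2
    have h3 : transportCost γ p p.1.1 ≤ dist p.1.1 p.1.1 - γ * dist p.1.1 p.1.2 := min_le_left _ _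
    rw [dist_self] at h3
    linarith
  linarith

end CyclicMonotonicity

/-! ### Representation of functionals by optimal measures -/

section Representation

variable {M : Type*} [MetricSpace M] {o : M}

/-- The de Leeuw transform as a linear map into the bounded functions. -/
def deLeeuwLinear (o : M) : Lip0 M o →ₗ[ℝ] BA.boundedFunctions (OffDiag M) where
  toFun f := ⟨f.deLeeuw, ‖f‖, f.abs_deLeeuw_le⟩
  map_add' f g := Subtype.ext (Lip0.deLeeuw_add f g)
  map_smul' c f := Subtype.ext (Lip0.deLeeuw_smul c f)

theorem deLeeuwLinear_injective : Function.Injective (deLeeuwLinear (M := M) o) := by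
  rw [← LinearMap.ker_eq_bot, LinearMap.ker_eq_bot']
  intro f hf
  refine norm_le_zero_iff.1 (f.norm_le_of_forall le_rfl fun p => ?_)
  have h : f.deLeeuw p = 0 := congrFun (congrArg Subtype.val hf) p
  simp [h]

/-- Swapping a pair reverses the sign of the slope, so the absolute value in the norm is
superfluous. -/
theorem Lip0.norm_le_iSup_deLeeuw [Nonempty (OffDiag M)] (f : Lip0 M o) :
    ‖f‖ ≤ ⨆ p, f.deLeeuw p := by
  have hb : BddAbove (Set.range f.deLeeuw) :=
    ⟨‖f‖, by rintro _ ⟨p, rfl⟩; exact (le_abs_self _).trans (f.abs_deLeeuw_le p)⟩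
  have h : ∀ p, |f.deLeeuw p| ≤ ⨆ p, f.deLeeuw p := fun p => by
    have h2 := le_ciSup hb (Lip0.swapPair p)
    rw [Lip0.deLeeuw_swapPair] at h2
    exact abs_le'.2 ⟨le_ciSup hb p, h2⟩
  exact f.norm_le_of_forall ((abs_nonneg _).trans (h (Classical.arbitrary _))) h

theorem adjointDeLeeuw_apply (μ : BA (OffDiag M)) (f : Lip0 M o) :
    adjointDeLeeuw o μ f = μ.integral f.deLeeuw := rfl

theorem norm_adjointDeLeeuw_le (μ : BA (OffDiag M)) : ‖adjointDeLeeuw o μ‖ ≤ ‖μ‖ :=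
  LinearMap.mkContinuous_norm_le _ μ.norm_nonneg' _

/-- Every functional of norm one on `Lip₀(M)` is represented by an optimal measure. -/
theorem exists_isOptimal_of_norm_eq_one (F : StrongDual ℝ (Lip0 M o)) (hF : ‖F‖ = 1) :
    ∃ μ : BA (OffDiag M), IsOptimal o μ ∧ ‖μ‖ = 1 ∧ adjointDeLeeuw o μ = F := by
  rcases isEmpty_or_nonempty (OffDiag M) with hE | hE
  -- Without pairs of distinct points the space is zero and carries no functional of norm one.
  · exfalso
    have h : ∀ f : Lip0 M o, f = 0 := fun f =>
      norm_le_zero_iff.1 (f.norm_le_of_forall le_rfl fun p => (hE.false p).elim)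
    have h0 : F = 0 := ContinuousLinearMap.ext fun f => by simp [h f]
    simp [h0] at hF
  let e := LinearEquiv.ofInjective (deLeeuwLinear (M := M) o) deLeeuwLinear_injective
  -- Domination by the supremum, rather than by the sup norm, forces the extension to be positive:
  -- `G (-h) ≤ sup (-h) ≤ 0` for `h ≥ 0`. It also gives total mass at most 1.
  obtain ⟨G, hGF, hG⟩ := exists_extension_of_le_sublinear
    ⟨LinearMap.range (deLeeuwLinear (M := M) o), F.toLinearMap ∘ₗ e.symm.toLinearMap⟩
    (fun h => ⨆ p, h.1 p)
    (fun c hc h => (Real.mul_iSup_of_nonneg hc.le _).symm)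
    (fun g h => ciSup_le fun p => add_le_add (le_ciSup (BA.boundedFunctions.bddAbove g) p)
      (le_ciSup (BA.boundedFunctions.bddAbove h) p))
    (by
      intro h
      obtain ⟨f, rfl⟩ := e.surjective h
      change F (e.symm (e f)) ≤ ⨆ p, f.deLeeuw p
      rw [e.symm_apply_apply]
      have h1 := (le_abs_self _).trans (F.le_opNorm f)
      rw [hF, one_mul] at h1
      exact h1.trans f.norm_le_iSup_deLeeuw)
  have hGf : ∀ f : Lip0 M o, G (deLeeuwLinear o f) = F f := fun f => by
    have h1 : G (deLeeuwLinear o f) = F (e.symm (e f)) := hGF (e f)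
    rwa [e.symm_apply_apply] at h1
  have hpos : ∀ h : BA.boundedFunctions (OffDiag M), 0 ≤ h.1 → 0 ≤ G h := fun h hh => by
    have h1 : G (-h) ≤ 0 := (hG (-h)).trans (ciSup_le fun p => neg_nonpos.2 (hh p))
    rw [map_neg] at h1
    linarith
  let μ := BA.ofLinear G hpos
  have hμpos : μ.IsPositive := fun A => hpos _ (Set.indicator_nonneg (by simp))
  have hμF : adjointDeLeeuw o μ = F := ContinuousLinearMap.ext fun f => by
    rw [← hGf]
    exact BA.integral_ofLinear G hpos (deLeeuwLinear o f)
  have hμle : ‖μ‖ ≤ 1 := by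
    rw [hμpos.norm_eq]
    exact (hG _).trans (ciSup_le fun p => by simp [BA.boundedIndicator])
  have hμ : ‖μ‖ = 1 := le_antisymm hμle (by rw [← hF, ← hμF]; exact norm_adjointDeLeeuw_le μ)
  exact ⟨μ, ⟨hμpos, by rw [hμF, hF, hμ]⟩, hμ, hμF⟩

end Representation

/-! ### Slices in terms of slopes -/

section Estimates

variable {M : Type*} [MetricSpace M] {o : M}

theorem IsOptimal.apply_compl {μ : BA (OffDiag M)} (hμ : IsOptimal o μ) (h1 : ‖μ‖ = 1)
    (A : Set (OffDiag M)) : μ Aᶜ = 1 - μ A := by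
  rw [hμ.1.norm_eq, ← μ.apply_add_compl A] at h1
  linarith

/-- A function in the unit ball that nearly attains the norm of `Φ^*μ` has large slopes except on
a set of small measure. -/
theorem IsOptimal.apply_slopes_lt {μ : BA (OffDiag M)} (hμ : IsOptimal o μ) (h1 : ‖μ‖ = 1)
    {f : Lip0 M o} (hf : ‖f‖ ≤ 1) {α γ : ℝ} (h : 1 - α < adjointDeLeeuw o μ f) :
    (1 - γ) * μ {p | f.deLeeuw p < γ} < α := by
  -- With `m` the measure of the set of small slopes, the integral is at most `γ * m + (1 - m)`.
  have h2 := hμ.1.integral_le (f.abs_deLeeuw_le) {p | f.deLeeuw p < γ} (a := γ) (b := 1)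
    (fun p hp => le_of_lt hp) fun p _ => (le_abs_self _).trans ((f.abs_deLeeuw_le p).trans hf)
  rw [hμ.apply_compl h1, ← adjointDeLeeuw_apply] at h2
  linarith

/-- A function in the unit ball with large slopes on a set of large measure nearly attains the norm
of `Φ^*μ`. -/
theorem IsOptimal.le_adjointDeLeeuw {μ : BA (OffDiag M)} (hμ : IsOptimal o μ) (h1 : ‖μ‖ = 1)
    {f : Lip0 M o} (hf : ‖f‖ ≤ 1) {γ : ℝ} (hγ : 0 ≤ γ) {A : Set (OffDiag M)} (hA : γ ≤ μ A)
    (h : ∀ p ∈ A, γ ≤ f.deLeeuw p) : γ * γ - (1 - γ) ≤ adjointDeLeeuw o μ f := by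
  have h2 := hμ.1.le_integral (f.abs_deLeeuw_le) A (a := γ) (b := -1) h
    fun p _ => (abs_le.1 ((f.abs_deLeeuw_le p).trans hf)).1
  rw [hμ.apply_compl h1, ← adjointDeLeeuw_apply] at h2
  have := mul_le_mul_of_nonneg_left hA hγ
  linarith

theorem deLeeuw_sum_smul {ι : Type*} (T : Finset ι) (lam : ι → ℝ) (f : ι → Lip0 M o)
    (p : OffDiag M) :
    (∑ i ∈ T, lam i • f i).deLeeuw p = ∑ i ∈ T, lam i * (f i).deLeeuw p := by
  let L : Lip0 M o →ₗ[ℝ] ℝ :=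
    { toFun := fun f => f.deLeeuw p
      map_add' := fun f g => congrFun (Lip0.deLeeuw_add f g) p
      map_smul' := fun c f => congrFun (Lip0.deLeeuw_smul c f) p }
  change L _ = ∑ i ∈ T, lam i * L (f i)
  simp

theorem deLeeuw_sub (f g : Lip0 M o) (p : OffDiag M) :
    (f - g).deLeeuw p = f.deLeeuw p - g.deLeeuw p := by
  change ((f p.1.1 - g p.1.1) - (f p.1.2 - g p.1.2)) / _ = _ / _ - _ / _
  ring

/-- The set of convex combinations of points of given sets. -/
def convexCombinations {X : Type*} [AddCommGroup X] [Module ℝ X] {n : ℕ} (lam : Fin n → ℝ)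
    (S : Fin n → Set X) : Set X :=
  {x | ∃ s : Fin n → X, (∀ i, s i ∈ S i) ∧ x = ∑ i, lam i • s i}

theorem norm_le_one_of_mem_convexCombinations {X : Type*} [NormedAddCommGroup X] [NormedSpace ℝ X]
    {n : ℕ} {lam : Fin n → ℝ} {S : Fin n → Set X} (h0 : ∀ i, 0 ≤ lam i) (h1 : ∑ i, lam i = 1)
    (hS : ∀ i, ∀ x ∈ S i, ‖x‖ ≤ 1) {x : X} (hx : x ∈ convexCombinations lam S) : ‖x‖ ≤ 1 := by
  obtain ⟨s, hs, rfl⟩ := hx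
  rw [← h1]
  refine (norm_sum_le _ _).trans (Finset.sum_le_sum fun i _ => ?_)
  rw [norm_smul, Real.norm_of_nonneg (h0 i)]
  exact mul_le_of_le_one_right (h0 i) (hS i _ (hs i))

/-- Functions in the unit ball whose average slopes at some pair differ by almost two have almost maximal
opposite slopes there. -/
theorem exists_opposite_slopes {n : ℕ} (hn : 1 ≤ n) {γ : ℝ} (hγ : (1 - γ) / n < 2) (f g : Fin n → Lip0 M o)
    (hf : ∀ i, ‖f i‖ ≤ 1) (hg : ∀ i, ‖g i‖ ≤ 1)
    (h : 2 - (1 - γ) / n < ‖∑ i, (1 / (n : ℝ)) • f i - ∑ i, (1 / (n : ℝ)) • g i‖) :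
    ∃ p : OffDiag M, ∀ i, γ ≤ (f i).deLeeuw p ∧ γ ≤ (g i).deLeeuw (Lip0.swapPair p) := by
  have hn0 : (1 : ℝ) ≤ n := by exact_mod_cast hn
  obtain ⟨p, hp⟩ : ∃ p, 2 - (1 - γ) / n <
      (∑ i, (1 / (n : ℝ)) • f i - ∑ i, (1 / (n : ℝ)) • g i).deLeeuw p := by
    by_contra! hcon
    -- An upper bound for all slopes also bounds their absolute values, by swapping pairs.
    refine h.not_ge (Lip0.norm_le_of_forall _ (by linarith) fun p => abs_le'.2 ⟨hcon p, ?_⟩)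
    rw [← Lip0.deLeeuw_swapPair]
    exact hcon _
  refine ⟨p, fun i => ?_⟩
  rw [deLeeuw_sub, deLeeuw_sum_smul, deLeeuw_sum_smul, ← Finset.mul_sum, ← Finset.mul_sum,
    ← mul_sub, ← Finset.sum_sub_distrib] at hp
  have hbf := fun j => abs_le.1 (((f j).abs_deLeeuw_le p).trans (hf j))
  have hbg := fun j => abs_le.1 (((g j).abs_deLeeuw_le p).trans (hg j))
  -- The deficits from 2 are nonnegative with sum below `1 - γ`, so each difference of slopes
  -- exceeds `1 + γ`. As slopes are at most 1 in absolute value, both parts exceed `γ`.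
  have h1 : ∑ j, (2 - ((f j).deLeeuw p - (g j).deLeeuw p)) < 1 - γ := by
    rw [Finset.sum_sub_distrib]
    simp only [Finset.sum_const, Finset.card_univ, Fintype.card_fin, nsmul_eq_mul]
    field_simp at hp
    linarith
  have h2 := (Finset.single_le_sum (f := fun j => 2 - ((f j).deLeeuw p - (g j).deLeeuw p))
    (fun j _ => by linarith [(hbf j).2, (hbg j).1]) (Finset.mem_univ i)).trans_lt h1
  rw [Lip0.deLeeuw_swapPair]
  constructor <;> linarith [(hbf i).2, (hbg i).1]

end Estimates

/-! ### The two implications -/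

theorem exists_cyclicallyMonotonic_of_hasSD2P {M : Type*} [MetricSpace M] {o : M}
    (hX : HasSD2P (Lip0 M o)) {n : ℕ} (hn : 1 ≤ n) (μ : Fin n → BA (OffDiag M))
    (hμ : ∀ i, IsOptimal o (μ i) ∧ ‖μ i‖ = 1) {γ : ℝ} (hγ : 0 < γ) (hγ1 : γ < 1) :
    ∃ (A : Fin n → Set (OffDiag M)) (u v : M) (huv : u ≠ v), ∀ i, γ ≤ μ i (A i) ∧
      IsCyclicallyMonotonic γ (A i ∪ {⟨(u, v), huv⟩}) ∧
      IsCyclicallyMonotonic γ (A i ∪ {⟨(v, u), huv.symm⟩}) := by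
  have hn0 : (0 : ℝ) < n := by exact_mod_cast hn
  have hδ : 0 < (1 - γ) / n := div_pos (by linarith) hn0
  have hδ2 : (1 - γ) / n < 2 := by
    rw [div_lt_iff₀ hn0]
    have : (1 : ℝ) ≤ n := by exact_mod_cast hn
    linarith
  -- With width `(1 - γ) ^ 2 / 2`, slopes below `γ` occupy measure less than `(1 - γ) / 2`.
  -- Discarding such a set for both `f i` and `g i` leaves measure at least `γ`.
  let S : Fin n → Set (Lip0 M o) := fun i =>
    {f | ‖f‖ ≤ 1 ∧ 1 - (1 - γ) ^ 2 / 2 < adjointDeLeeuw o (μ i) f}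
  have hdiam : Metric.diam (convexCombinations (fun _ => 1 / (n : ℝ)) S) = 2 :=
    hX n (fun _ => 1 / (n : ℝ)) S (fun _ => by positivity) (by simp [hn0.ne'])
      fun i => ⟨adjointDeLeeuw o (μ i), (1 - γ) ^ 2 / 2, by rw [(hμ i).1.2, (hμ i).2],
        by nlinarith [mul_pos (sub_pos.2 hγ1) (sub_pos.2 hγ1)], rfl⟩
  obtain ⟨f, hf, g, hg, hfg⟩ : ∃ f : Fin n → Lip0 M o, (∀ i, f i ∈ S i) ∧
      ∃ g : Fin n → Lip0 M o, (∀ i, g i ∈ S i) ∧ 2 - (1 - γ) / n <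
        ‖∑ i, (1 / (n : ℝ)) • f i - ∑ i, (1 / (n : ℝ)) • g i‖ := by
    by_contra! hcon
    have h := Metric.diam_le_of_forall_dist_le (by linarith : 0 ≤ 2 - (1 - γ) / n)
      (s := convexCombinations (fun _ => 1 / (n : ℝ)) S) (by
        rintro _ ⟨f, hf, rfl⟩ _ ⟨g, hg, rfl⟩
        rw [dist_eq_norm]
        exact hcon f hf g hg)
    linarith
  obtain ⟨⟨⟨u, v⟩, huv⟩, hp⟩ := exists_opposite_slopes hn hδ2 f g (fun i => (hf i).1)
    (fun i => (hg i).1) hfg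
  refine ⟨fun i => {p | γ ≤ (f i).deLeeuw p ∧ γ ≤ (g i).deLeeuw p}, u, v, huv, fun i =>
    ⟨?_, isCyclicallyMonotonic_of_deLeeuw (f i) (hf i).1 ?_,
      isCyclicallyMonotonic_of_deLeeuw (g i) (hg i).1 ?_⟩⟩
  · have h1 := (hμ i).1.apply_slopes_lt (hμ i).2 (γ := γ) (hf i).1 (hf i).2
    have h2 := (hμ i).1.apply_slopes_lt (hμ i).2 (γ := γ) (hg i).1 (hg i).2
    have h3 := (hμ i).1.apply_compl (hμ i).2 {p | γ ≤ (f i).deLeeuw p ∧ γ ≤ (g i).deLeeuw p}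
    have h4 : μ i {p | γ ≤ (f i).deLeeuw p ∧ γ ≤ (g i).deLeeuw p}ᶜ
        ≤ μ i {p | (f i).deLeeuw p < γ} + μ i {p | (g i).deLeeuw p < γ} := by
      refine le_trans ((hμ i).1.1.mono fun p hp => ?_) ((hμ i).1.1.union_le _ _)
      rcases not_and_or.1 hp with hp | hp
      exacts [Or.inl (not_le.1 hp), Or.inr (not_le.1 hp)]
    by_contra! hlt
    nlinarith
  · rintro p (hpA | rfl)
    · exact hpA.1
    · exact (hp i).1
  · rintro p (hpA | rfl)
    · exact hpA.2
    · exact (hp i).2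

theorem hasSD2P_of_exists_cyclicallyMonotonic {M : Type*} [MetricSpace M] {o : M}
    (h : ∀ (n : ℕ), 1 ≤ n → ∀ (μ : Fin n → BA (OffDiag M)),
        (∀ i, IsOptimal o (μ i) ∧ ‖μ i‖ = 1) → ∀ γ : ℝ, 0 < γ → γ < 1 →
          ∃ (A : Fin n → Set (OffDiag M)) (u v : M) (huv : u ≠ v), ∀ i,
            γ ≤ μ i (A i) ∧
            IsCyclicallyMonotonic γ (A i ∪ {⟨(u, v), huv⟩}) ∧
            IsCyclicallyMonotonic γ (A i ∪ {⟨(v, u), huv.symm⟩})) :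
    HasSD2P (Lip0 M o) := by
  intro n lam S h0 h1 hS
  have hn : 1 ≤ n := by
    rcases Nat.eq_zero_or_pos n with rfl | hn
    · simp at h1
    · exact hn
  choose F α hF hα hSF using hS
  choose μ hμ hμ1 hμF using fun i => exists_isOptimal_of_norm_eq_one (F i) (hF i)
  have hball : ∀ i, ∀ x ∈ S i, ‖x‖ ≤ 1 := fun i x hx => by
    rw [hSF i] at hx
    exact hx.1
  have hnorm : ∀ x ∈ convexCombinations lam S, ‖x‖ ≤ 1 := fun x hx =>
    norm_le_one_of_mem_convexCombinations h0 h1 hball hx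
  have hdist : ∀ x ∈ convexCombinations lam S, ∀ y ∈ convexCombinations lam S, dist x y ≤ 2 :=
    fun x hx y hy => by
      rw [dist_eq_norm]
      linarith [norm_sub_le x y, hnorm x hx, hnorm y hy]
  refine le_antisymm (Metric.diam_le_of_forall_dist_le zero_le_two hdist) ?_
  -- The last condition puts every function of the unit ball with slopes at least `γ` on `A i` into
  -- the slice `S i`.
  have key : ∀ γ : ℝ, 0 < γ → γ < 1 → (∀ i, 1 - α i < γ * γ - (1 - γ)) →
      2 * γ ≤ Metric.diam (convexCombinations lam S) := by
    intro γ hγ hγ1 hγα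
    obtain ⟨A, u, v, huv, hA⟩ := h n hn μ (fun i => ⟨hμ i, hμ1 i⟩) γ hγ hγ1
    choose f hf hfA using fun i => (hA i).2.1.exists_lip0 o
    choose g hg hgA using fun i => (hA i).2.2.exists_lip0 o
    have hmem : ∀ (i) (f : Lip0 M o), ‖f‖ ≤ 1 → (∀ p ∈ A i, γ ≤ f.deLeeuw p) → f ∈ S i := by
      intro i f hf hfA
      rw [hSF i, ← hμF i]
      exact ⟨hf, (hγα i).trans_le ((hμ i).le_adjointDeLeeuw (hμ1 i) hf hγ.le (hA i).1 hfA)⟩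
    have hx : ∑ i, lam i • f i ∈ convexCombinations lam S :=
      ⟨f, fun i => hmem i _ (hf i) fun p hp => hfA i p (Or.inl hp), rfl⟩
    have hy : ∑ i, lam i • g i ∈ convexCombinations lam S :=
      ⟨g, fun i => hmem i _ (hg i) fun p hp => hgA i p (Or.inl hp), rfl⟩
    refine le_trans ?_ (Metric.dist_le_diam_of_mem (Metric.isBounded_iff.2 ⟨2, hdist⟩) hx hy)
    rw [dist_eq_norm]
    let q : OffDiag M := ⟨(u, v), huv⟩
    -- The norm is tested at `(u, v)`, where each `f i - g i` has slope at least `2 * γ`.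
    refine le_trans ?_ ((le_abs_self _).trans (Lip0.abs_deLeeuw_le _ q))
    rw [deLeeuw_sub, deLeeuw_sum_smul, deLeeuw_sum_smul, ← Finset.sum_sub_distrib, ← mul_one (2 * γ),
      ← h1, Finset.mul_sum]
    refine Finset.sum_le_sum fun i _ => ?_
    have h2 : γ ≤ (f i).deLeeuw q := hfA i _ (Or.inr rfl)
    have h3 : γ ≤ (g i).deLeeuw (Lip0.swapPair q) := hgA i _ (Or.inr rfl)
    rw [Lip0.deLeeuw_swapPair] at h3
    nlinarith [h0 i]
  have hlim : Filter.Tendsto (fun γ : ℝ => γ * γ - (1 - γ)) (nhdsWithin 1 (Set.Iio 1)) (nhds 1) := by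
    have hc : Continuous fun γ : ℝ => γ * γ - (1 - γ) := by fun_prop
    simpa using (hc.tendsto 1).mono_left nhdsWithin_le_nhds
  have hlim2 : Filter.Tendsto (fun γ : ℝ => 2 * γ) (nhdsWithin 1 (Set.Iio 1)) (nhds 2) := by
    have hc : Continuous fun γ : ℝ => 2 * γ := by fun_prop
    simpa using (hc.tendsto 1).mono_left nhdsWithin_le_nhds
  refine le_of_tendsto hlim2 ?_
  -- As there are finitely many slices, one `γ` near 1 suits all the widths `α i`.
  have hev : ∀ᶠ γ : ℝ in nhdsWithin 1 (Set.Iio 1), ∀ i, 1 - α i < γ * γ - (1 - γ) :=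
    Filter.eventually_all.2 fun i => hlim.eventually_const_lt (by linarith [hα i])
  filter_upwards [hev, self_mem_nhdsWithin,
    nhdsWithin_le_nhds (lt_mem_nhds (zero_lt_one (α := ℝ)))] with γ hγα hγ1 hγ
  exact key γ hγ hγ1 hγα

end

theorem proposition3p6 {M : Type*} [MetricSpace M] (o : M) :
    HasSD2P (Lip0 M o) ↔
      ∀ (n : ℕ), 1 ≤ n → ∀ (μ : Fin n → BA (OffDiag M)),
        (∀ i, IsOptimal o (μ i) ∧ ‖μ i‖ = 1) → ∀ γ : ℝ, 0 < γ → γ < 1 →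
          ∃ (A : Fin n → Set (OffDiag M)) (u v : M) (huv : u ≠ v), ∀ i,
            γ ≤ μ i (A i) ∧
            IsCyclicallyMonotonic γ (A i ∪ {⟨(u, v), huv⟩}) ∧
            IsCyclicallyMonotonic γ (A i ∪ {⟨(v, u), huv.symm⟩}) :=
  ⟨fun hX _ hn μ hμ _ hγ hγ1 => exists_cyclicallyMonotonic_of_hasSD2P hX hn μ hμ hγ hγ1,
    hasSD2P_of_exists_cyclicallyMonotonic⟩
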